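/- Let $N\ge 1$ and $m$ be natural numbers. For a tensor $\mathcal X\in\mathbb R^{I_1\times\cdots\times I_N}$ let $X_{(i)}$ be its mode-$i$ unfolding (the matrix with $I_i$ rows whose columns are the mode-$i$ fibers of $\mathcal X$), let $\|\mathcal X\|_F$ be its Frobenius norm (the Euclidean norm of its entries), and let $\|\mathcal X\|_*=\frac1N\sum_{i=1}^N\|X_{(i)}\|_*$, where the trace norm $\|A\|_*$ of a matrix $A$ is the sum of its singular values $\sigma_1(A)\ge\sigma_2(A)\ge\cdots$ (continued by zeros), and $\|A\|_2=\sigma_1(A)$. We say that $\mathcal X$ has rank $(r_1,\dots,r_N)$ or less if $\operatorname{rank}X_{(i)}\le r_i$ for all $i$. Let $\mathfrak F:\mathbb R^{I_1\times\cdots\times I_N}\to\mathbb R^m$ be a linear operator, and suppose there is $\Delta>0$ such that every nonzero $\mathcal H\in\operatorname{Null}(\mathfrak F)$ satisfies $$\frac{\|\mathcal H\|_*}{\|\mathcal H\|_F}\ \ge\ \sqrt{\frac m\Delta}.$$ Let $\alpha>0$, natural numbers $r_1,\dots,r_N$ and real numbers $s_1,\dots,s_N\ge 0$ be fixed, with $$m\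 \ge\ \Bigl(2+\frac{s_i}{\alpha}\Bigr)^2 r_i\,\Delta\qquad(i=1,\dots,N).$$ Then every nonzero $\mathcal H\in\operatorname{Null}(\mathfrak F)$ satisfies the null-space condition $$\sum_{i=1}^N\sum_{j=r_i+1}^{I_i}\sigma_j(H_{(i)})\ \ge\ \sum_{i=1}^N\Bigl(1+\frac{s_i}{\alpha}\Bigr)\sum_{j=1}^{r_i}\sigma_j(H_{(i)}),$$ and every tensor $\mathcal X^0$ of rank $(r_1,\dots,r_N)$ or less with $\|X^0_{(i)}\|_2\le s_i$ for all $i$ (in particular every one with $\|X^0_{(i)}\|_2=s_i$) is recovered from the measurements $b=\mathfrak F(\mathcal X^0)$: $\mathcal X^0$ is the unique solution of $$\min_{\mathcal X}\Bigl\{\|\mathcal X\|_*+\frac1{2\alpha}\|\mathcal X\|_F^2:\ \mathfrak F(\mathcal X)=b\Bigr\}.$$ -/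

import Mathlib

noncomputable section

namespace TensorRecovery

/-- Real `N`-way tensors of size `I 0 × ⋯ × I (N - 1)`: real arrays indexed by multi-indices.
The norm of this Euclidean space is the Frobenius norm `√(∑ X k ^ 2)`. -/
abbrev Tensor {N : ℕ} (I : Fin N → ℕ) : Type :=
  EuclideanSpace ℝ ((k : Fin N) → Fin (I k))

/-- The column indices of the mode-`n` unfolding: the multi-indices with the `n`-th entry removed.
(Numbering them in some order permutes the columns, which changes neither rank nor singular
values.) -/
abbrev ColIdx {N : ℕ} (I : Fin N → ℕ) (n : Fin N) : Type :=
  (k : {k : Fin N // k ≠ n}) → Fin (I k)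

/-- The mode-`n` unfolding `X₍ₙ₎`, whose columns are the mode-`n` fibers of `X`: its entry at
row `a` and column `c` is the entry of `X` whose `n`-th index is `a` and whose other indices
are given by `c`. -/
def unfold {N : ℕ} {I : Fin N → ℕ} (n : Fin N) (X : Tensor I) :
    Matrix (Fin (I n)) (ColIdx I n) ℝ :=
  Matrix.of fun a c => X ((Equiv.piSplitAt n fun k => Fin (I k)).symm (a, c))

/-- The singular values of a real matrix in decreasing order, with multiplicity, counted from `0`
and continued by zeros: `singVal A j` is the `(j + 1)`-st largest singular value. -/
def singVal {p : ℕ} {q : Type} [Fintype q] [DecidableEq q] (A : Matrix (Fin p) q ℝ) (j : ℕ) : ℝ :=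
  (Matrix.toEuclideanLin A).singularValues j

/-- The trace norm of a matrix: the sum of its singular values. A matrix with `p` rows has at most
`p` nonzero ones. -/
def matrixTraceNorm {p : ℕ} {q : Type} [Fintype q] [DecidableEq q]
    (A : Matrix (Fin p) q ℝ) : ℝ :=
  ∑ j ∈ Finset.range p, singVal A j

/-- The spectral norm of a matrix: its largest singular value. -/
def spectralNorm {p : ℕ} {q : Type} [Fintype q] [DecidableEq q] (A : Matrix (Fin p) q ℝ) : ℝ :=
  singVal A 0

/-- The tensor trace norm: the mean of the trace norms of the unfoldings. -/
def traceNorm {N : ℕ} {I : Fin N → ℕ} (X : Tensor I) : ℝ :=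
  (1 / (N : ℝ)) * ∑ i : Fin N, matrixTraceNorm (unfold i X)

/-- `X` has `n`-rank at most `r n` for every mode `n`. -/
def RankLE {N : ℕ} {I : Fin N → ℕ} (X : Tensor I) (r : Fin N → ℕ) : Prop :=
  ∀ n : Fin N, (unfold n X).rank ≤ r n

/-- The objective `‖X‖_* + ‖X‖_F² / (2 α)` of the augmented trace norm model. -/
def augObjective {N : ℕ} {I : Fin N → ℕ} (α : ℝ) (X : Tensor I) : ℝ :=
  traceNorm X + 1 / (2 * α) * ‖X‖ ^ 2

/-- `X₀` is the unique solution of the augmented model: minimize `augObjective α X` subject to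
`F X = b`. -/
def IsUniqueAugSolution {N m : ℕ} {I : Fin N → ℕ} (α : ℝ)
    (F : Tensor I →ₗ[ℝ] EuclideanSpace ℝ (Fin m)) (b : EuclideanSpace ℝ (Fin m))
    (X₀ : Tensor I) : Prop :=
  F X₀ = b ∧ ∀ X : Tensor I, F X = b → X ≠ X₀ → augObjective α X₀ < augObjective α X

/-- The augmented null-space condition for the operator `F`, the rank bounds `r`, the spectral
norms `s` and the parameter `α`. -/
def AugNullSpaceCondition {N m : ℕ} {I : Fin N → ℕ} (α : ℝ)
    (F : Tensor I →ₗ[ℝ] EuclideanSpace ℝ (Fin m)) (r : Fin N → ℕ) (s : Fin N → ℝ) : Prop :=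
  ∀ H ∈ LinearMap.ker F, H ≠ 0 →
    ∑ i : Fin N, (1 + s i / α) * ∑ j ∈ Finset.range (r i), singVal (unfold i H) j ≤
      ∑ i : Fin N, ∑ j ∈ Finset.Ico (r i) (I i), singVal (unfold i H) j

end TensorRecovery

end

/-! Null-space condition: the trace norm of each unfolding of `H` splits into a head (the first `r
i` singular values) and a tail. Cauchy–Schwarz bounds the head by `√(r i) * ‖H‖`, so the hypothesis
on `m` makes `2 + s i / α` heads cost at most `√(m / Δ) * ‖H‖`. Summed over the modes this is at
most the sum of the trace norms, that is, heads plus tails; cancelling one head per mode leaves the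
condition.

Recovery: for a competitor `X₀ + H` the objective changes by the trace norm difference, plus `⟪X₀,
H⟫ / α`, plus `‖H‖ ^ 2 / (2 * α)`. In each mode the trace norm grows by at least tail minus head
(`matrixTraceNorm_add_le`), and von Neumann's inequality gives `⟪X₀, H⟫ ≥ -s i * head`
(`neg_sum_mul_le_singVal`). Averaged over the modes, the null-space condition makes the first two
terms nonnegative together; the quadratic term makes the increase strict.

The hard ingredient is the trace norm growth, a case of Mirsky's inequality. It is obtained by
bounding, block by block, the eigenvalues of one self-adjoint operator that dominates the dilations
of `A` and of `-B` and whose trace is the trace norm of `A + B`. -/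

section

open Module InnerProductSpace Finset

namespace LinearMap

variable {E F G : Type*} [NormedAddCommGroup E] [InnerProductSpace ℝ E] [FiniteDimensional ℝ E]
  [NormedAddCommGroup F] [InnerProductSpace ℝ F] [FiniteDimensional ℝ F]
  [NormedAddCommGroup G] [InnerProductSpace ℝ G] [FiniteDimensional ℝ G]

/-! ### Singular value decomposition and min-max eigenvalue bounds -/

/-- The singular value decomposition of a real linear map. -/
theorem exists_singularValueDecomposition (T : E →ₗ[ℝ] F) :
    ∃ (e : Fin (finrank ℝ T.range) → E) (f : Fin (finrank ℝ T.range) → F),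
      Orthonormal ℝ e ∧ Orthonormal ℝ f ∧
        ∀ x, T x = ∑ i : Fin (finrank ℝ T.range), (T.singularValues i * inner ℝ (e i) x) • f i := by
  have hle : finrank ℝ T.range ≤ finrank ℝ E := T.finrank_range_le
  set b := T.isSymmetric_adjoint_comp_self.eigenvectorBasis rfl with hb
  -- The images of the eigenvectors of `T† T` are orthogonal with norms the singular values;
  -- normalizing the nonzero ones gives the left singular vectors.
  have hTT : ∀ i j, inner ℝ (T (b i)) (T (b j)) =
      if i = j then T.singularValues i ^ 2 else 0 := by
    intro i j
    rw [← LinearMap.adjoint_inner_right]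
    have : adjoint T (T (b j)) = T.singularValues j ^ 2 • b j := by
      rw [T.sq_singularValues_fin rfl j]
      exact T.isSymmetric_adjoint_comp_self.apply_eigenvectorBasis rfl j
    rw [this, inner_smul_right, orthonormal_iff_ite.mp b.orthonormal]
    split_ifs with h <;> simp [h]
  have hpos : ∀ i : Fin (finrank ℝ T.range), 0 < T.singularValues i := fun i =>
    T.singularValues_pos_iff_lt_finrank_range.mpr i.2
  refine ⟨fun i => b (Fin.castLE hle i),
    fun i => (T.singularValues i)⁻¹ • T (b (Fin.castLE hle i)),
    b.orthonormal.comp _ (Fin.castLE_injective hle), ?_, ?_⟩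
  · rw [orthonormal_iff_ite]
    intro i j
    rw [inner_smul_left, inner_smul_right, hTT]
    have := (hpos i).ne'
    by_cases h : i = j
    · subst h
      simp
      field_simp
    · simp [h]
  · intro x
    conv_lhs => rw [← b.sum_repr x, map_sum]
    symm
    refine Fintype.sum_of_injective (Fin.castLE hle) (Fin.castLE_injective hle) _ _ ?_ ?_
    · intro i hi
      have h0 : T.singularValues i = 0 := by
        rw [T.singularValues_eq_zero_iff_le_finrank_range]
        by_contra! h
        exact hi ⟨⟨i, h⟩, rfl⟩
      have : T (b i) = 0 := by
        rw [← inner_self_eq_zero (𝕜 := ℝ), hTT]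
        simp [h0]
      simp [this]
    · intro i
      have := (hpos i).ne'
      rw [map_smul, smul_smul, b.repr_apply_apply]
      congr 1
      field_simp

/-- Courant–Fischer: a space of dimension above `i` contains a nonzero vector orthogonal to the
first `i` eigenvectors, and there the quadratic form is at most the `i`-th eigenvalue times the
squared norm. -/
theorem IsSymmetric.le_eigenvalues_of_injective {V : Type*} [AddCommGroup V] [Module ℝ V]
    [FiniteDimensional ℝ V] {T : G →ₗ[ℝ] G} (hT : T.IsSymmetric) {n : ℕ} (hn : finrank ℝ G = n)
    (i : Fin n) (φ : V →ₗ[ℝ] G) (hφ : Function.Injective φ) (hi : (i : ℕ) < finrank ℝ V) {c : ℝ}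
    (hc : ∀ v, c * ‖φ v‖ ^ 2 ≤ inner ℝ (T (φ v)) (φ v)) : c ≤ hT.eigenvalues hn i := by
  set b := hT.eigenvectorBasis hn
  let ψ : V →ₗ[ℝ] (Fin i → ℝ) :=
    LinearMap.pi fun k => (innerₛₗ ℝ (b (Fin.castLE i.2.le k))) ∘ₗ φ
  obtain ⟨v, hv, hv0⟩ := Submodule.exists_mem_ne_zero_of_ne_bot
    (ψ.ker_ne_bot_of_finrank_lt (by simpa using hi))
  have hx0 : φ v ≠ 0 := fun h => hv0 (hφ (by simpa using h))
  have hrep : ∀ k : Fin n, k < i → inner ℝ (b k) (φ v) = 0 := fun k hk => by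
    have := congrFun hv ⟨k, hk⟩
    simpa [ψ] using this
  have h1 : inner ℝ (T (φ v)) (φ v) = ∑ k, hT.eigenvalues hn k * inner ℝ (b k) (φ v) ^ 2 := by
    rw [← b.sum_inner_mul_inner]
    refine Finset.sum_congr rfl fun k _ => ?_
    rw [hT, hT.apply_eigenvectorBasis, inner_smul_right, real_inner_comm]
    simp [b]
    ring
  have h2 : ‖φ v‖ ^ 2 = ∑ k, inner ℝ (b k) (φ v) ^ 2 := by
    rw [← b.sum_sq_norm_inner_right]
    simp
  have h3 : inner ℝ (T (φ v)) (φ v) ≤ hT.eigenvalues hn i * ‖φ v‖ ^ 2 := by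
    rw [h1, h2, Finset.mul_sum]
    refine Finset.sum_le_sum fun k _ => ?_
    rcases lt_or_ge k i with hk | hk
    · simp [hrep k hk]
    · exact mul_le_mul_of_nonneg_right (hT.eigenvalues_antitone hn hk) (sq_nonneg _)
  exact le_of_mul_le_mul_right ((hc v).trans h3) (by positivity)

theorem IsSymmetric.le_eigenvalues_of_ker {T : G →ₗ[ℝ] G} (hT : T.IsSymmetric) {n : ℕ}
    (hn : finrank ℝ G = n) (i : Fin n) {k : ℕ} (ψ : G →ₗ[ℝ] (Fin k → ℝ)) (hi : (i : ℕ) + k < n)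
    {c : ℝ} (hc : ∀ x, ψ x = 0 → c * ‖x‖ ^ 2 ≤ inner ℝ (T x) x) : c ≤ hT.eigenvalues hn i := by
  refine hT.le_eigenvalues_of_injective hn i (ker ψ).subtype (ker ψ).injective_subtype ?_
    fun v => hc v v.2
  have h1 := ψ.finrank_range_add_finrank_ker
  have h2 := (Submodule.finrank_le ψ.range)
  simp only [finrank_fintype_fun_eq_card, Fintype.card_fin] at h2
  omega

/-! ### Von Neumann's trace inequality -/

/-- `∑ j, t j * σ j` with `0 ≤ t ≤ 1` of total mass at most `r` and `σ` antitone and nonnegative is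
at most the sum of the first `r` values of `σ`. -/
theorem _root_.Antitone.sum_mul_le_sum_range {σ : ℕ → ℝ} (hσ : Antitone σ) (h0 : ∀ j, 0 ≤ σ j)
    {n r : ℕ} {t : ℕ → ℝ} (ht0 : ∀ j, 0 ≤ t j) (ht1 : ∀ j, t j ≤ 1)
    (ht : ∑ j ∈ Finset.range n, t j ≤ r) :
    ∑ j ∈ Finset.range n, t j * σ j ≤ ∑ j ∈ Finset.range r, σ j := by
  rcases le_total n r with h | h
  · calc ∑ j ∈ Finset.range n, t j * σ j ≤ ∑ j ∈ Finset.range n, σ j :=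
          sum_le_sum fun j _ => mul_le_of_le_one_left (h0 j) (ht1 j)
      _ ≤ _ := sum_le_sum_of_subset_of_nonneg (by simpa using h) fun j _ _ => h0 j
  · rw [← sum_range_add_sum_Ico _ h] at ht ⊢
    -- The mass beyond `r` is at most the mass missing before `r`; both are compared at the
    -- threshold value `σ r`.
    have h1 : ∑ j ∈ Finset.range r, σ r * (1 - t j) ≤ ∑ j ∈ Finset.range r, (σ j - t j * σ j) :=
      sum_le_sum fun j hj => by
        have := hσ (Finset.mem_range.mp hj).le
        nlinarith [ht1 j]
    have h2 : ∑ j ∈ Ico r n, t j * σ j ≤ ∑ j ∈ Ico r n, t j * σ r :=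
      sum_le_sum fun j hj => mul_le_mul_of_nonneg_left (hσ (mem_Ico.mp hj).1) (ht0 j)
    rw [← mul_sum, sum_sub_distrib, sum_sub_distrib] at h1
    rw [← sum_mul] at h2
    simp only [sum_const, card_range, nsmul_eq_mul, mul_one] at h1
    nlinarith [h0 r]

/-- Bessel's inequality, summed over a second orthonormal family. -/
theorem _root_.Orthonormal.sum_sum_inner_sq_le {H : Type*} [NormedAddCommGroup H] [InnerProductSpace ℝ H] {m n : ℕ} {u : Fin m → H} (hu : Orthonormal ℝ u) {v : Fin n → H}
    (hv : Orthonormal ℝ v) : ∑ j, ∑ i, inner ℝ (u i) (v j) ^ 2 ≤ m := by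
  rw [sum_comm]
  calc ∑ i, ∑ j, inner ℝ (u i) (v j) ^ 2 ≤ ∑ i : Fin m, (1 : ℝ) := by
        refine sum_le_sum fun i _ => ?_
        have := hv.sum_inner_products_le (u i) (s := univ)
        simpa [hu.1 i, real_inner_comm] using this
    _ = m := by simp

/-- A form of von Neumann's trace inequality for a map of rank at most `r` with singular values
bounded by `s`. -/
theorem neg_sum_mul_inner_le (A B : E →ₗ[ℝ] F) {r : ℕ} {s : ℝ} (hr : finrank ℝ A.range ≤ r)
    (hs : A.singularValues 0 ≤ s) {n : ℕ} {e : Fin n → E} {f : Fin n → F} (he : Orthonormal ℝ e)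
    (hf : Orthonormal ℝ f) :
    -∑ j : Fin n, B.singularValues j * inner ℝ (f j) (A (e j)) ≤
      s * ∑ j ∈ Finset.range r, B.singularValues j := by
  obtain ⟨v, u, hv, hu, hA⟩ := A.exists_singularValueDecomposition
  have hs0 : 0 ≤ s := (A.singularValues_nonneg 0).trans hs
  -- Expanding `A` in its singular vectors and using `-x * y ≤ (x ^ 2 + y ^ 2) / 2` produces these
  -- weights. Bessel's inequality bounds each by `1` and their total by the rank of `A`.
  set t : Fin n → ℝ := fun j =>
    ((∑ i, inner ℝ (v i) (e j) ^ 2) + ∑ i, inner ℝ (u i) (f j) ^ 2) / 2 with ht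
  have ht0 : ∀ j, 0 ≤ t j := fun j => by positivity
  have ht1 : ∀ j, t j ≤ 1 := fun j => by
    have h1 := hv.sum_inner_products_le (e j) (s := univ)
    have h2 := hu.sum_inner_products_le (f j) (s := univ)
    simp [he.1 j, hf.1 j] at h1 h2
    simp only [ht]
    linarith
  have htr : ∑ j, t j ≤ r := by
    have h1 := hv.sum_sum_inner_sq_le he
    have h2 := hu.sum_sum_inner_sq_le hf
    have h3 : (finrank ℝ A.range : ℝ) ≤ r := by exact_mod_cast hr
    rw [ht, ← sum_div, sum_add_distrib]
    linarith
  have hat : ∀ j, -inner ℝ (f j) (A (e j)) ≤ s * t j := by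
    intro j
    simp only [ht]
    rw [hA, inner_sum, ← sum_neg_distrib, ← sum_add_distrib, mul_div_assoc', mul_sum, sum_div]
    refine sum_le_sum fun i _ => ?_
    rw [inner_smul_right, real_inner_comm (u i) (f j)]
    have h1 := A.singularValues_nonneg i
    have h2 := (A.singularValues_antitone (Nat.zero_le i)).trans hs
    set x := inner ℝ (v i) (e j)
    set y := inner ℝ (u i) (f j)
    nlinarith [mul_nonneg h1 (sq_nonneg (x + y)),
      mul_nonneg (sub_nonneg.mpr h2) (add_nonneg (sq_nonneg x) (sq_nonneg y))]
  set t' : ℕ → ℝ := fun j => if h : j < n then t ⟨j, h⟩ else 0 with ht'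
  have htt : ∀ j : Fin n, t' j = t j := fun j => by simp [ht']
  calc -∑ j : Fin n, B.singularValues j * inner ℝ (f j) (A (e j))
      ≤ ∑ j : Fin n, s * (t' j * B.singularValues j) := by
        rw [← sum_neg_distrib]
        refine sum_le_sum fun j _ => ?_
        rw [htt]
        nlinarith [mul_le_mul_of_nonneg_left (hat j) (B.singularValues_nonneg j)]
    _ = s * ∑ j ∈ Finset.range n, t' j * B.singularValues j := by
        rw [← mul_sum, ← Fin.sum_univ_eq_sum_range (fun j => t' j * B.singularValues j)]
    _ ≤ _ := by
        refine mul_le_mul_of_nonneg_left (B.singularValues_antitone.sum_mul_le_sum_range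
          B.singularValues_nonneg (fun j => ?_) (fun j => ?_) ?_) hs0
        · simp only [ht']; split_ifs; exacts [ht0 _, le_rfl]
        · simp only [ht']; split_ifs; exacts [ht1 _, zero_le_one]
        · rw [← Fin.sum_univ_eq_sum_range t']
          simpa only [htt] using htr

theorem sum_singularValues_eq_of_finrank_range_le (T : E →ₗ[ℝ] F) {n : ℕ}
    (hn : finrank ℝ T.range ≤ n) :
    ∑ j ∈ Finset.range n, T.singularValues j =
      ∑ j ∈ Finset.range (finrank ℝ T.range), T.singularValues j := by
  symm
  refine sum_subset (by simpa using hn) fun j _ hj => ?_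
  rw [T.singularValues_eq_zero_iff_le_finrank_range]
  simpa using hj

/-! ### Hermitian dilation and eigenvalues of dominating operators -/

/-- The Hermitian dilation `(y, x) ↦ (T x, T† y)`. -/
noncomputable def dilation (T : E →ₗ[ℝ] F) : WithLp 2 (F × E) →ₗ[ℝ] WithLp 2 (F × E) where
  toFun z := WithLp.toLp 2 (T z.snd, adjoint T z.fst)
  map_add' x y := WithLp.ofLp_injective 2 (by ext <;> simp)
  map_smul' c x := WithLp.ofLp_injective 2 (by ext <;> simp)

theorem inner_dilation (T : E →ₗ[ℝ] F) (z w : WithLp 2 (F × E)) :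
    inner ℝ (T.dilation z) w = inner ℝ (T z.snd) w.fst + inner ℝ z.fst (T w.snd) := by
  simp [dilation, WithLp.prod_inner_apply, adjoint_inner_left]

theorem isSymmetric_dilation (T : E →ₗ[ℝ] F) : T.dilation.IsSymmetric := by
  intro z w
  rw [inner_dilation, real_inner_comm (T.dilation w), inner_dilation, real_inner_comm w.fst,
    real_inner_comm (T w.snd), add_comm]

theorem inner_dilation_self (T : E →ₗ[ℝ] F) (z : WithLp 2 (F × E)) :
    inner ℝ (T.dilation z) z = 2 * inner ℝ z.fst (T z.snd) := by
  rw [inner_dilation, real_inner_comm, two_mul]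

/-- Changing the sign of the second component conjugates the dilation into its negative. -/
theorem trace_dilation (T : E →ₗ[ℝ] F) : trace ℝ _ T.dilation = 0 := by
  let J : WithLp 2 (F × E) →ₗ[ℝ] WithLp 2 (F × E) :=
    { toFun z := WithLp.toLp 2 (z.fst, -z.snd)
      map_add' x y := WithLp.ofLp_injective 2 (by ext <;> simp [add_comm])
      map_smul' c x := WithLp.ofLp_injective 2 (by ext <;> simp) }
  have hJ : J * (T.dilation * J) = -T.dilation := by
    refine LinearMap.ext fun z => WithLp.ofLp_injective 2 ?_
    ext <;> simp [J, dilation]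
  have hJJ : T.dilation * J * J = T.dilation := by
    refine LinearMap.ext fun z => WithLp.ofLp_injective 2 ?_
    ext <;> simp [J, dilation]
  have := trace_mul_comm ℝ J (T.dilation * J)
  rw [hJ, hJJ, map_neg] at this
  linarith

theorem sq_norm_withLp_prod {E F : Type*} [NormedAddCommGroup E] [NormedAddCommGroup F]
    (z : WithLp 2 (F × E)) : ‖z‖ ^ 2 = ‖z.fst‖ ^ 2 + ‖z.snd‖ ^ 2 :=
  WithLp.prod_norm_sq_eq_of_L2 z

/-- A self-adjoint operator dominating the dilation of `T` has its `i`-th eigenvalue bounded below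
by the `i`-th singular value, as long as the latter is positive. -/
theorem singularValues_le_eigenvalues_of_pos (T : E →ₗ[ℝ] F)
    {Z : WithLp 2 (F × E) →ₗ[ℝ] WithLp 2 (F × E)} (hZ : Z.IsSymmetric) {d : ℕ}
    (hd : finrank ℝ (WithLp 2 (F × E)) = d)
    (hle : ∀ z, 2 * inner ℝ z.fst (T z.snd) ≤ inner ℝ (Z z) z) (i : Fin d)
    (hi : (i : ℕ) < finrank ℝ T.range) : T.singularValues i ≤ hZ.eigenvalues hd i := by
  obtain ⟨e, f, he, hf, hT⟩ := T.exists_singularValueDecomposition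
  have hin : (i : ℕ) + 1 ≤ finrank ℝ T.range := hi
  set k := Fin.castLE hin with hk
  have he' : Orthonormal ℝ (e ∘ k) := he.comp k (Fin.castLE_injective hin)
  have hf' : Orthonormal ℝ (f ∘ k) := hf.comp k (Fin.castLE_injective hin)
  -- The test space is spanned by the pairs `(f j, e j)` with `j ≤ i`, eigenvectors of the dilation
  -- for its top singular values.
  let φ : (Fin (i + 1) → ℝ) →ₗ[ℝ] WithLp 2 (F × E) :=
    { toFun c := WithLp.toLp 2 (∑ j, c j • (f ∘ k) j, ∑ j, c j • (e ∘ k) j)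
      map_add' x y := WithLp.ofLp_injective 2 (by ext <;> simp [add_smul, sum_add_distrib])
      map_smul' c x := WithLp.ofLp_injective 2 (by ext <;> simp [mul_smul, smul_sum]) }
  have hnorm : ∀ c, ‖φ c‖ ^ 2 = 2 * ∑ j, c j ^ 2 := by
    intro c
    rw [sq_norm_withLp_prod, ← real_inner_self_eq_norm_sq, ← real_inner_self_eq_norm_sq]
    simp only [φ, LinearMap.coe_mk, AddHom.coe_mk, WithLp.toLp_fst, WithLp.toLp_snd]
    rw [hf'.inner_sum, he'.inner_sum]
    simp [sq, two_mul]
  have hTe : ∀ j, T (e j) = T.singularValues j • f j := by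
    intro j
    rw [hT]
    simp [orthonormal_iff_ite.mp he]
  refine hZ.le_eigenvalues_of_injective hd i φ ?_ (by simp) fun c => (le_trans ?_ (hle _))
  · rw [injective_iff_map_eq_zero]
    intro c hc
    have h := hnorm c
    rw [hc] at h
    simp only [norm_zero, ne_eq, OfNat.ofNat_ne_zero, not_false_eq_true, zero_pow] at h
    have h0 : ∑ j, c j ^ 2 = 0 := by linarith
    rw [sum_eq_zero_iff_of_nonneg fun _ _ => sq_nonneg _] at h0
    ext j
    simpa using h0 j (mem_univ j)
  · rw [hnorm]
    have : inner ℝ (φ c).fst (T (φ c).snd) = ∑ j : Fin (i + 1), T.singularValues j * c j ^ 2 := by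
      have hTs : T (φ c).snd = ∑ j : Fin (i + 1), (c j * T.singularValues j) • (f ∘ k) j := by
        simp [φ, hTe, smul_smul, hk]
      rw [hTs]
      simp only [φ, LinearMap.coe_mk, AddHom.coe_mk, WithLp.toLp_fst]
      rw [hf'.inner_sum]
      refine sum_congr rfl fun j _ => ?_
      simp
      ring
    rw [this, mul_left_comm, mul_sum]
    refine mul_le_mul_of_nonneg_left (sum_le_sum fun j _ => ?_) zero_le_two
    exact mul_le_mul_of_nonneg_right (T.singularValues_antitone (Nat.lt_succ_iff.mp j.2))
      (sq_nonneg _)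

/-- A self-adjoint operator dominating the dilation of `T` has `k`-th eigenvalue from below at least
`-σ_k(T)`. -/
theorem neg_singularValues_le_eigenvalues (T : E →ₗ[ℝ] F)
    {Z : WithLp 2 (F × E) →ₗ[ℝ] WithLp 2 (F × E)} (hZ : Z.IsSymmetric) {d : ℕ}
    (hd : finrank ℝ (WithLp 2 (F × E)) = d)
    (hle : ∀ z, 2 * inner ℝ z.fst (T z.snd) ≤ inner ℝ (Z z) z) (i : Fin d) {k : ℕ}
    (hi : (i : ℕ) + k < d) : -T.singularValues k ≤ hZ.eigenvalues hd i := by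
  obtain ⟨e, f, he, hf, hT⟩ := T.exists_singularValueDecomposition
  -- Orthogonality to the first `k` right singular vectors suffices; indices past the rank impose no
  -- condition, hence the zero functional.
  let ψ : WithLp 2 (F × E) →ₗ[ℝ] (Fin k → ℝ) :=
    LinearMap.pi fun j => if h : (j : ℕ) < finrank ℝ T.range then
      (innerₛₗ ℝ (e ⟨j, h⟩)) ∘ₗ (WithLp.sndₗ 2 ℝ F E) else 0
  refine hZ.le_eigenvalues_of_ker hd i ψ hi fun z hz => le_trans ?_ (hle z)
  have hz' : ∀ j : Fin (finrank ℝ T.range), (j : ℕ) < k → inner ℝ (e j) z.snd = 0 := fun j hj => by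
    have := congrFun hz ⟨j, hj⟩
    simpa [ψ] using this
  rw [hT, inner_sum, mul_sum, sq_norm_withLp_prod]
  have h1 := he.sum_inner_products_le z.snd (s := univ)
  have h2 := hf.sum_inner_products_le z.fst (s := univ)
  simp only [Real.norm_eq_abs, sq_abs] at h1 h2
  have hk := T.singularValues_nonneg k
  calc -T.singularValues k * (‖z.fst‖ ^ 2 + ‖z.snd‖ ^ 2)
      ≤ -T.singularValues k * (∑ j, inner ℝ (f j) z.fst ^ 2 + ∑ j, inner ℝ (e j) z.snd ^ 2) := by
        nlinarith
    _ ≤ _ := by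
        rw [← sum_add_distrib, mul_sum]
        refine sum_le_sum fun j _ => ?_
        rw [inner_smul_right, real_inner_comm (f j) z.fst]
        rcases lt_or_ge (j : ℕ) k with hj | hj
        · rw [hz' j hj]
          nlinarith [sq_nonneg (inner ℝ (f j) z.fst)]
        · have h3 := T.singularValues_antitone hj
          have h4 := T.singularValues_nonneg j
          set x := inner ℝ (e j) z.snd
          set y := inner ℝ (f j) z.fst
          nlinarith [mul_nonneg h4 (sq_nonneg (x + y)),
            mul_nonneg (sub_nonneg.mpr h3) (add_nonneg (sq_nonneg x) (sq_nonneg y))]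

/-- Past the rank the singular value is zero while the eigenvalue could be negative, hence the sign
hypothesis. -/
theorem singularValues_le_eigenvalues (T : E →ₗ[ℝ] F)
    {Z : WithLp 2 (F × E) →ₗ[ℝ] WithLp 2 (F × E)} (hZ : Z.IsSymmetric) {d : ℕ}
    (hd : finrank ℝ (WithLp 2 (F × E)) = d)
    (hle : ∀ z, 2 * inner ℝ z.fst (T z.snd) ≤ inner ℝ (Z z) z) (i : Fin d)
    (h0 : 0 ≤ hZ.eigenvalues hd i) : T.singularValues i ≤ hZ.eigenvalues hd i := by
  rcases lt_or_ge (i : ℕ) (finrank ℝ T.range) with hi | hi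
  · exact T.singularValues_le_eigenvalues_of_pos hZ hd hle i hi
  · rwa [T.singularValues_eq_zero_iff_le_finrank_range.mpr hi]

@[simp]
theorem singularValues_neg (T : E →ₗ[ℝ] F) : (-T).singularValues = T.singularValues := by
  have h : adjoint (-T) ∘ₗ (-T) = adjoint T ∘ₗ T := by
    rw [map_neg]
    ext
    simp
  ext i
  rcases lt_or_ge i (finrank ℝ E) with hi | hi
  · rw [singularValues_of_lt _ rfl hi, singularValues_of_lt _ rfl hi]
    congr 2
  · rw [singularValues_of_finrank_le _ hi, singularValues_of_finrank_le _ hi]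

/-! ### Mirsky-type inequality for the trace norm -/

/-- A self-adjoint operator dominating the dilation of `A` and of `-B`. -/
theorem exists_isSymmetric_dilation_le (A B : E →ₗ[ℝ] F) :
    ∃ Z : WithLp 2 (F × E) →ₗ[ℝ] WithLp 2 (F × E), Z.IsSymmetric ∧
      (∀ z, 2 * inner ℝ z.fst (A z.snd) ≤ inner ℝ (Z z) z) ∧
      (∀ z, 2 * inner ℝ z.fst ((-B) z.snd) ≤ inner ℝ (Z z) z) ∧
      trace ℝ _ Z =
        ∑ j ∈ Finset.range (finrank ℝ (A + B).range), (A + B).singularValues j := by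
  obtain ⟨e, f, he, hf, hC⟩ := (A + B).exists_singularValueDecomposition
  -- The vectors `(f i, -e i)`, of squared norm `2`, are eigenvectors of the dilation of `A + B` for
  -- `-σ_i`. So `M` below is its negative part, and adding `M` to that dilation leaves the positive
  -- part.
  set w : Fin (finrank ℝ (A + B).range) → WithLp 2 (F × E) :=
    fun i => WithLp.toLp 2 (f i, -e i) with hw
  let M : WithLp 2 (F × E) →ₗ[ℝ] WithLp 2 (F × E) :=
    ∑ i : Fin (finrank ℝ (A + B).range), ((A + B).singularValues i / 2) • (rankOne ℝ (w i) (w i)).toLinearMap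
  have hM : ∀ z, inner ℝ (M z) z =
      ∑ i : Fin (finrank ℝ (A + B).range), (A + B).singularValues i / 2 * (inner ℝ (f i) z.fst - inner ℝ (e i) z.snd) ^ 2 := by
    intro z
    simp only [M, LinearMap.sum_apply, sum_inner]
    refine sum_congr rfl fun i _ => ?_
    simp [inner_smul_left, hw, WithLp.prod_inner_apply]
    left
    ring
  have hMsymm : M.IsSymmetric := by
    intro x y
    simp only [M, LinearMap.sum_apply, sum_inner, inner_sum]
    refine sum_congr rfl fun i _ => ?_
    simp [inner_smul_left, inner_smul_right, real_inner_comm]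
    left
    ring
  refine ⟨A.dilation + M, A.isSymmetric_dilation.add hMsymm, fun z => ?_, fun z => ?_, ?_⟩
  · rw [add_apply, inner_add_left, inner_dilation_self, hM]
    have : 0 ≤ ∑ i : Fin (finrank ℝ (A + B).range), (A + B).singularValues i / 2 *
        (inner ℝ (f i) z.fst - inner ℝ (e i) z.snd) ^ 2 :=
      sum_nonneg fun i _ => mul_nonneg (div_nonneg (singularValues_nonneg _ _) zero_le_two)
        (sq_nonneg _)
    linarith
  · rw [add_apply, inner_add_left, inner_dilation_self, hM]
    have h1 : inner ℝ z.fst ((A + B) z.snd) = inner ℝ z.fst (A z.snd) + inner ℝ z.fst (B z.snd) := by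
      rw [add_apply, inner_add_right]
    have h2 : 0 ≤ 2 * inner ℝ z.fst ((A + B) z.snd) + ∑ i : Fin (finrank ℝ (A + B).range), (A + B).singularValues i / 2 *
        (inner ℝ (f i) z.fst - inner ℝ (e i) z.snd) ^ 2 := by
      rw [hC, inner_sum, mul_sum, ← sum_add_distrib]
      refine sum_nonneg fun i _ => ?_
      rw [inner_smul_right, real_inner_comm (f i) z.fst]
      have := (A + B).singularValues_nonneg i
      nlinarith [mul_nonneg this (sq_nonneg (inner ℝ (f i) z.fst + inner ℝ (e i) z.snd))]
    rw [neg_apply, inner_neg_right]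
    linarith
  · rw [map_add, trace_dilation, zero_add, map_sum,
      ← Fin.sum_univ_eq_sum_range (fun j => (A + B).singularValues j)]
    refine sum_congr rfl fun i _ => ?_
    rw [map_smul, InnerProductSpace.trace_rankOne]
    simp [hw, sq_norm_withLp_prod, he.1, hf.1]
    ring

/-- A consequence of Mirsky's inequality `∑ |σ_j(A) - σ_j(-B)| ≤ ∑ σ_j(A + B)`. -/
theorem sum_singularValues_add_le (A B : E →ₗ[ℝ] F) :
    ∑ j ∈ Finset.range (finrank ℝ A.range), A.singularValues j +
      ∑ j ∈ Finset.range (finrank ℝ B.range), B.singularValues j ≤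
      ∑ j ∈ Finset.range (finrank ℝ (A + B).range), (A + B).singularValues j +
        2 * ∑ j ∈ Finset.range (finrank ℝ A.range), B.singularValues j := by
  obtain ⟨Z, hZ, hA, hB, htr⟩ := exists_isSymmetric_dilation_le A B
  set d := finrank ℝ (WithLp 2 (F × E)) with hd
  set ρ := finrank ℝ A.range
  set τ := finrank ℝ B.range
  have hdim : d = finrank ℝ F + finrank ℝ E := by
    rw [hd, (WithLp.linearEquiv 2 ℝ (F × E)).finrank_eq, finrank_prod]
  have h1 : ρ ≤ finrank ℝ E := A.finrank_range_le
  have h2 : ρ ≤ finrank ℝ F := Submodule.finrank_le _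
  have h3 : τ ≤ finrank ℝ E := B.finrank_range_le
  -- All but the last `ρ` eigenvalues of `Z` are nonnegative, because the singular value of `A` at
  -- index `ρ` vanishes.
  have h0 : ∀ i : Fin d, (i : ℕ) + ρ < d → 0 ≤ hZ.eigenvalues hd.symm i := fun i hi => by
    have := A.neg_singularValues_le_eigenvalues hZ hd.symm hA i hi
    rwa [A.singularValues_finrank_range_self, neg_zero] at this
  set l : ℕ → ℝ := fun i => if h : i < d then hZ.eigenvalues hd.symm ⟨i, h⟩ else 0 with hl
  have htr' : trace ℝ _ Z = ∑ i ∈ Finset.range d, l i := by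
    rw [hZ.trace_eq_sum_eigenvalues hd.symm, ← Fin.sum_univ_eq_sum_range l]
    simp [hl]
  -- The spectrum of `Z` is cut at `ρ` and `d - ρ`: the top block dominates the singular values of
  -- `A`, the middle one those of `B` from index `ρ` on, and the bottom one the negatives of the
  -- first `ρ` of `B`.
  rw [← htr, htr', ← sum_range_add_sum_Ico l (show d - ρ ≤ d by omega),
    ← sum_range_add_sum_Ico l (show ρ ≤ d - ρ by omega)]
  rw [← B.sum_singularValues_eq_of_finrank_range_le (show τ ≤ d - ρ by omega),
    ← sum_range_add_sum_Ico _ (show ρ ≤ d - ρ by omega)]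
  have e1 : ∑ j ∈ Finset.range ρ, A.singularValues j ≤ ∑ j ∈ Finset.range ρ, l j := by
    refine sum_le_sum fun j hj => ?_
    rw [Finset.mem_range] at hj
    have hjd : j < d := by omega
    simp only [hl, hjd, dif_pos]
    exact A.singularValues_le_eigenvalues_of_pos hZ hd.symm hA ⟨j, hjd⟩ hj
  have e2 : ∑ j ∈ Ico ρ (d - ρ), B.singularValues j ≤ ∑ j ∈ Ico ρ (d - ρ), l j := by
    refine sum_le_sum fun j hj => ?_
    rw [Finset.mem_Ico] at hj
    have hjd : j < d := by omega
    simp only [hl, hjd, dif_pos]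
    have := (-B).singularValues_le_eigenvalues hZ hd.symm hB ⟨j, hjd⟩
      (h0 _ (by simp only; omega))
    rwa [singularValues_neg] at this
  have e3 : -∑ j ∈ Finset.range ρ, B.singularValues j ≤ ∑ j ∈ Ico (d - ρ) d, l j := by
    -- The eigenvalue at `d - ρ + j` has `ρ - 1 - j` others after it, so it is paired with the
    -- singular value of `B` at that index, in reversed order.
    rw [sum_Ico_eq_sum_range, show d - (d - ρ) = ρ by omega,
      ← sum_range_reflect (fun j => B.singularValues j), ← sum_neg_distrib]
    refine sum_le_sum fun j hj => ?_
    rw [Finset.mem_range] at hj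
    have hjd : d - ρ + j < d := by omega
    simp only [hl, hjd, dif_pos]
    have := (-B).neg_singularValues_le_eigenvalues hZ hd.symm hB ⟨d - ρ + j, hjd⟩
      (k := ρ - 1 - j) (by simp only; omega)
    rwa [singularValues_neg] at this
  linarith

end LinearMap

/-! ### Matrix inequalities for heads and tails of singular values -/

namespace TensorRecovery

section Matrix

variable {p : ℕ} {q : Type} [Fintype q] [DecidableEq q]

theorem singVal_nonneg (A : Matrix (Fin p) q ℝ) (j : ℕ) : 0 ≤ singVal A j :=
  LinearMap.singularValues_nonneg _ j

theorem finrank_range_toEuclideanLin (A : Matrix (Fin p) q ℝ) :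
    finrank ℝ (Matrix.toEuclideanLin A).range = A.rank := by
  rw [Matrix.toEuclideanLin_eq_toLin_orthonormal, ← Matrix.rank_eq_finrank_range_toLin]

theorem finrank_range_toEuclideanLin_le (A : Matrix (Fin p) q ℝ) :
    finrank ℝ (Matrix.toEuclideanLin A).range ≤ p := by
  simpa using Submodule.finrank_le (Matrix.toEuclideanLin A).range

theorem matrixTraceNorm_eq_sum_finrank (A : Matrix (Fin p) q ℝ) :
    matrixTraceNorm A = ∑ j ∈ range (finrank ℝ (Matrix.toEuclideanLin A).range), singVal A j :=
  LinearMap.sum_singularValues_eq_of_finrank_range_le _ (finrank_range_toEuclideanLin_le A)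

/-- Writing `B` as `∑ σ_j f_j e_jᵀ` turns the entrywise pairing with `A` into the form von Neumann's
inequality needs; `A = B` gives the Frobenius norm. -/
theorem exists_sum_mul_eq_sum_singVal (B : Matrix (Fin p) q ℝ) :
    ∃ (e : Fin (finrank ℝ (Matrix.toEuclideanLin B).range) → EuclideanSpace ℝ q)
      (f : Fin (finrank ℝ (Matrix.toEuclideanLin B).range) → EuclideanSpace ℝ (Fin p)),
      Orthonormal ℝ e ∧ Orthonormal ℝ f ∧
      (∀ j, Matrix.toEuclideanLin B (e j) = singVal B j • f j) ∧
      ∀ A : Matrix (Fin p) q ℝ, ∑ a, ∑ c, A a c * B a c =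
        ∑ j : Fin (finrank ℝ (Matrix.toEuclideanLin B).range),
          singVal B j * inner ℝ (f j) (Matrix.toEuclideanLin A (e j)) := by
  obtain ⟨e, f, he, hf, hB⟩ := (Matrix.toEuclideanLin B).exists_singularValueDecomposition
  refine ⟨e, f, he, hf, fun j => ?_, fun A => ?_⟩
  · rw [hB]
    simp [orthonormal_iff_ite.mp he, singVal]
  · have hent : ∀ a c, B a c =
        ∑ j : Fin (finrank ℝ (Matrix.toEuclideanLin B).range), singVal B j * e j c * f j a := by
      intro a c
      have h := congrArg (fun v : EuclideanSpace ℝ (Fin p) => v a)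
        (hB (EuclideanSpace.single c 1))
      simpa [EuclideanSpace.inner_single_right, singVal] using h
    have hin : ∀ j, inner ℝ (f j) (Matrix.toEuclideanLin A (e j)) =
        ∑ a, ∑ c, A a c * e j c * f j a := by
      intro j
      simp [PiLp.inner_apply, Matrix.toLpLin_apply, Matrix.mulVec, dotProduct, sum_mul]
    simp_rw [hin, hent, mul_sum]
    conv_rhs => rw [sum_comm]
    refine sum_congr rfl fun a _ => ?_
    rw [sum_comm]
    refine sum_congr rfl fun c _ => sum_congr rfl fun j _ => ?_
    ring

theorem sum_sq_eq_sum_singVal_sq (B : Matrix (Fin p) q ℝ) :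
    ∑ a, ∑ c, B a c * B a c =
      ∑ j ∈ range (finrank ℝ (Matrix.toEuclideanLin B).range), singVal B j ^ 2 := by
  obtain ⟨e, f, -, hf, he, h⟩ := exists_sum_mul_eq_sum_singVal B
  rw [h B, ← Fin.sum_univ_eq_sum_range (fun j => singVal B j ^ 2)]
  refine sum_congr rfl fun j _ => ?_
  rw [he, inner_smul_right, real_inner_self_eq_norm_sq, hf.1]
  ring

theorem sum_range_singVal_le (B : Matrix (Fin p) q ℝ) (r : ℕ) :
    ∑ j ∈ range r, singVal B j ≤ √r * √(∑ a, ∑ c, B a c * B a c) := by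
  have h1 := sq_sum_le_card_mul_sum_sq (s := range r) (f := fun j => singVal B j)
  have h2 : ∑ j ∈ range r, singVal B j ^ 2 ≤ ∑ a, ∑ c, B a c * B a c := by
    rw [sum_sq_eq_sum_singVal_sq]
    set ρ := finrank ℝ (Matrix.toEuclideanLin B).range
    -- No relation between `r` and the rank is assumed; terms past the rank are zero.
    calc ∑ j ∈ range r, singVal B j ^ 2 ≤ ∑ j ∈ range (max r ρ), singVal B j ^ 2 :=
          sum_le_sum_of_subset_of_nonneg (by simp) fun j _ _ => sq_nonneg _
      _ = ∑ j ∈ range ρ, singVal B j ^ 2 := by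
          refine (sum_subset (by simp) fun j _ hj => ?_).symm
          rw [singVal, (LinearMap.singularValues_eq_zero_iff_le_finrank_range _).mpr
            (by simpa [ρ] using hj)]
          simp
  rw [← Real.sqrt_mul (Nat.cast_nonneg r)]
  refine Real.le_sqrt_of_sq_le (h1.trans ?_)
  rw [card_range]
  gcongr

theorem matrixTraceNorm_le (B : Matrix (Fin p) q ℝ) (r : ℕ) :
    matrixTraceNorm B ≤ ∑ j ∈ range r, singVal B j + ∑ j ∈ Ico r p, singVal B j := by
  rcases le_total r p with h | h
  · exact (sum_range_add_sum_Ico _ h).ge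
  · rw [Ico_eq_empty_of_le h, sum_empty, add_zero]
    exact sum_le_sum_of_subset_of_nonneg (by simpa using h) fun j _ _ => singVal_nonneg B j

theorem neg_sum_mul_le_singVal (A B : Matrix (Fin p) q ℝ) {r : ℕ} {s : ℝ} (hr : A.rank ≤ r)
    (hs : spectralNorm A ≤ s) :
    -∑ a, ∑ c, A a c * B a c ≤ s * ∑ j ∈ range r, singVal B j := by
  obtain ⟨e, f, he, hf, -, h⟩ := exists_sum_mul_eq_sum_singVal B
  rw [h A]
  exact LinearMap.neg_sum_mul_inner_le _ (Matrix.toEuclideanLin B)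
    (by rwa [finrank_range_toEuclideanLin]) hs he hf

theorem matrixTraceNorm_add_le (A B : Matrix (Fin p) q ℝ) {r : ℕ} (hr : A.rank ≤ r) :
    matrixTraceNorm A + matrixTraceNorm B ≤
      matrixTraceNorm (A + B) + 2 * ∑ j ∈ range r, singVal B j := by
  have h := LinearMap.sum_singularValues_add_le (Matrix.toEuclideanLin A) (Matrix.toEuclideanLin B)
  rw [← map_add] at h
  have h2 : ∑ j ∈ range (finrank ℝ (Matrix.toEuclideanLin A).range), singVal B j ≤
      ∑ j ∈ range r, singVal B j :=
    sum_le_sum_of_subset_of_nonneg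
      (by rw [range_subset_range, finrank_range_toEuclideanLin]; exact hr)
      fun j _ _ => singVal_nonneg B j
  rw [matrixTraceNorm_eq_sum_finrank A, matrixTraceNorm_eq_sum_finrank B,
    matrixTraceNorm_eq_sum_finrank (A + B)]
  simp only [singVal] at h2 ⊢
  linarith

theorem sum_Ico_singVal_le (B : Matrix (Fin p) q ℝ) (r : ℕ) :
    ∑ j ∈ Ico r p, singVal B j ≤ matrixTraceNorm B - ∑ j ∈ range r, singVal B j := by
  have h : ∑ j ∈ range (max r p), singVal B j = matrixTraceNorm B := by
    rw [matrixTraceNorm_eq_sum_finrank]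
    exact LinearMap.sum_singularValues_eq_of_finrank_range_le _
      ((finrank_range_toEuclideanLin_le B).trans (le_max_right _ _))
  rw [← h, ← sum_range_add_sum_Ico _ (le_max_left r p), add_sub_cancel_left]
  exact sum_le_sum_of_subset_of_nonneg (Ico_subset_Ico_right (le_max_right _ _))
    fun j _ _ => singVal_nonneg B j

end Matrix

/-! ### Null-space condition and recovery for tensors -/

section Tensor

variable {N : ℕ} {I : Fin N → ℕ}

theorem unfold_add (i : Fin N) (X Y : Tensor I) : unfold i (X + Y) = unfold i X + unfold i Y :=
  rfl

/-- Unfolding only rearranges entries, so the same inner product can be estimated in every mode. -/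
theorem sum_unfold_mul_unfold (i : Fin N) (X Y : Tensor I) :
    ∑ a, ∑ c, unfold i X a c * unfold i Y a c = inner ℝ X Y := by
  rw [← Fintype.sum_prod_type' (fun a c => unfold i X a c * unfold i Y a c), PiLp.inner_apply]
  refine Fintype.sum_equiv (Equiv.piSplitAt i fun k => Fin (I k)).symm _ _ fun x => ?_
  simp [unfold, mul_comm]

theorem sum_range_singVal_unfold_le (i : Fin N) (X : Tensor I) (r : ℕ) :
    ∑ j ∈ range r, singVal (unfold i X) j ≤ √r * ‖X‖ := by
  have h := sum_range_singVal_le (unfold i X) r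
  rwa [sum_unfold_mul_unfold, real_inner_self_eq_norm_sq, Real.sqrt_sq (norm_nonneg X)] at h

/-- The augmented null-space condition follows from a lower bound on the ratio of the trace norm to
the Frobenius norm on the kernel. -/
theorem augNullSpaceCondition_of_le_traceNorm_div_norm {m : ℕ} (hN : 0 < N)
    (F : Tensor I →ₗ[ℝ] EuclideanSpace ℝ (Fin m)) {Δ : ℝ} (hΔ : 0 < Δ)
    (hF : ∀ H ∈ LinearMap.ker F, H ≠ 0 → √((m : ℝ) / Δ) ≤ traceNorm H / ‖H‖)
    {α : ℝ} (hα : 0 < α) {r : Fin N → ℕ} {s : Fin N → ℝ} (hs : ∀ i, 0 ≤ s i)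
    (hm : ∀ i, (2 + s i / α) ^ 2 * (r i : ℝ) * Δ ≤ m) : AugNullSpaceCondition α F r s := by
  intro H hH hH0
  have hHpos : 0 < ‖H‖ := norm_pos_iff.mpr hH0
  have h1 : √((m : ℝ) / Δ) * ‖H‖ ≤ traceNorm H := (le_div_iff₀ hHpos).mp (hF H hH hH0)
  have hNr : (0 : ℝ) < N := by exact_mod_cast hN
  have h2 : ∑ _i : Fin N, √((m : ℝ) / Δ) * ‖H‖ ≤ ∑ i, matrixTraceNorm (unfold i H) := by
    rw [traceNorm, one_div, inv_mul_eq_div, le_div_iff₀ hNr] at h1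
    simpa [mul_comm] using h1
  have h3 : ∀ i, (2 + s i / α) * ∑ j ∈ range (r i), singVal (unfold i H) j ≤
      √((m : ℝ) / Δ) * ‖H‖ := by
    intro i
    have hsa : 0 ≤ 2 + s i / α := by have := hs i; positivity
    calc (2 + s i / α) * ∑ j ∈ range (r i), singVal (unfold i H) j
        ≤ (2 + s i / α) * (√(r i) * ‖H‖) := by
          gcongr
          exact sum_range_singVal_unfold_le i H (r i)
      _ = √((2 + s i / α) ^ 2 * r i) * ‖H‖ := by
          rw [Real.sqrt_mul (sq_nonneg _), Real.sqrt_sq hsa, mul_assoc]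
      _ ≤ _ := by
          gcongr
          rw [le_div_iff₀ hΔ]
          exact hm i
  have h4 := (sum_le_sum fun i (_ : i ∈ univ) => h3 i).trans h2
  have h5 := sum_le_sum fun i (_ : i ∈ univ) => matrixTraceNorm_le (unfold i H) (r i)
  rw [sum_add_distrib] at h5
  have h6 : ∑ i, (2 + s i / α) * ∑ j ∈ range (r i), singVal (unfold i H) j =
      ∑ i, (1 + s i / α) * ∑ j ∈ range (r i), singVal (unfold i H) j +
        ∑ i, ∑ j ∈ range (r i), singVal (unfold i H) j := by
    rw [← sum_add_distrib]
    exact sum_congr rfl fun i _ => by ring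
  linarith

/-- Under the augmented null-space condition, low-rank tensors of bounded spectral norm are
recovered. -/
theorem AugNullSpaceCondition.isUniqueAugSolution {m : ℕ} (hN : 0 < N)
    {F : Tensor I →ₗ[ℝ] EuclideanSpace ℝ (Fin m)} {α : ℝ} (hα : 0 < α) {r : Fin N → ℕ}
    {s : Fin N → ℝ} (h : AugNullSpaceCondition α F r s) {X₀ : Tensor I} (hr : RankLE X₀ r)
    (hs : ∀ i, spectralNorm (unfold i X₀) ≤ s i) : IsUniqueAugSolution α F (F X₀) X₀ := by
  refine ⟨rfl, fun X hX hne => ?_⟩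
  obtain ⟨H, rfl⟩ : ∃ H, X = X₀ + H := ⟨X - X₀, by abel⟩
  have hker : H ∈ LinearMap.ker F := by simpa using hX
  have hH0 : H ≠ 0 := by simpa using hne
  have hHpos : 0 < ‖H‖ := norm_pos_iff.mpr hH0
  have hNr : (0 : ℝ) < N := by exact_mod_cast hN
  have hmode : ∀ i, ∑ j ∈ Ico (r i) (I i), singVal (unfold i H) j -
      (1 + s i / α) * ∑ j ∈ range (r i), singVal (unfold i H) j ≤
      matrixTraceNorm (unfold i (X₀ + H)) - matrixTraceNorm (unfold i X₀) +
        inner ℝ X₀ H / α := by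
    intro i
    have h1 := neg_sum_mul_le_singVal (unfold i X₀) (unfold i H) (hr i) (hs i)
    rw [sum_unfold_mul_unfold] at h1
    have h2 := matrixTraceNorm_add_le (unfold i X₀) (unfold i H) (hr i)
    have h3 := sum_Ico_singVal_le (unfold i H) (r i)
    have h4 := div_le_div_of_nonneg_right h1 hα.le
    rw [unfold_add]
    rw [neg_div, mul_div_right_comm] at h4
    linarith
  have hsum := sum_le_sum fun i (_ : i ∈ univ) => hmode i
  have hnsp := h H hker hH0
  rw [sum_sub_distrib, sum_add_distrib, sum_sub_distrib] at hsum
  simp only [sum_const, card_univ, Fintype.card_fin, nsmul_eq_mul] at hsum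
  have hnonneg : 0 ≤ traceNorm (X₀ + H) - traceNorm X₀ + inner ℝ X₀ H / α := by
    have : traceNorm (X₀ + H) - traceNorm X₀ + inner ℝ X₀ H / α = 1 / (N : ℝ) *
        (∑ i, matrixTraceNorm (unfold i (X₀ + H)) - ∑ i, matrixTraceNorm (unfold i X₀) +
          N * (inner ℝ X₀ H / α)) := by
      rw [traceNorm, traceNorm]
      field_simp
    rw [this]
    exact mul_nonneg (by positivity) (by linarith)
  have hquad : 1 / (2 * α) * ‖X₀ + H‖ ^ 2 =
      1 / (2 * α) * ‖X₀‖ ^ 2 + inner ℝ X₀ H / α + 1 / (2 * α) * ‖H‖ ^ 2 := by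
    rw [norm_add_sq_real]
    field_simp
  have hpos : 0 < 1 / (2 * α) * ‖H‖ ^ 2 := by positivity
  rw [augObjective, augObjective, hquad]
  linarith

end Tensor

end TensorRecovery

end

theorem theorem10 {N m : ℕ} (hN : 0 < N) (I : Fin N → ℕ)
    (F : TensorRecovery.Tensor I →ₗ[ℝ] EuclideanSpace ℝ (Fin m))
    (Δ : ℝ) (hΔ : 0 < Δ)
    (hSSP : ∀ H ∈ LinearMap.ker F, H ≠ 0 →
      TensorRecovery.traceNorm H / ‖H‖ ≥ Real.sqrt ((m : ℝ) / Δ))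
    (α : ℝ) (hα : 0 < α) (r : Fin N → ℕ)
    (s : Fin N → ℝ) (hs : ∀ i, 0 ≤ s i)
    (hm : ∀ i, (m : ℝ) ≥ (2 + s i / α) ^ 2 * (r i : ℝ) * Δ) :
    TensorRecovery.AugNullSpaceCondition α F r s ∧
      ∀ X₀ : TensorRecovery.Tensor I, TensorRecovery.RankLE X₀ r →
        (∀ i, TensorRecovery.spectralNorm (TensorRecovery.unfold i X₀) ≤ s i) →
          TensorRecovery.IsUniqueAugSolution α F (F X₀) X₀ := by
  have h := TensorRecovery.augNullSpaceCondition_of_le_traceNorm_div_norm hN F hΔ hSSP hα hs hm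
  exact ⟨h, fun X₀ hr hX₀ => h.isUniqueAugSolution hN hα hr hX₀⟩
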